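/- **Setting.** An effective Boolean algebra $\mathcal A$ has a domain $\mathcal D$, a set $\Psi$ of (finitely represented) predicates with denotations $\llbracket\psi\rrbracket\subseteq\mathcal D$, contains $\bot,\top$, is closed under $\vee,\wedge,\neg$ (interpreted as union, intersection, complement), and $\llbracket\psi\rrbracket\ne\emptyset$ is decidable. A binary $X$-tree is a function to $X$ from a finite prefix-closed set of positions $\mathrm{dom}\subseteq\{0,1\}^*$; $\Lambda$ is the empty tree, and $x[t_1,t_2]$ is the tree with root label $x$ and subtrees $t_1,t_2$. A symbolic tree automaton $M$ over $\mathcal A$ has a finite set of states $Q$, an initial state $q_0$, final states $F\subseteq Q$, and a finite set of transitions $(q_1,\psi,q_2,q_3)\in Q\times\Psi\times Q\times Q$. The languages at states are the least sets such that $\Lambda\in\mathcal L_q(M)$ if $q\in F$, and $d[t_1,t_2]\in\mathcal L_{q_3}(M)$ whenever $(q_1,\psi,q_2,q_3)$ is a transition, $d\in\llbracket\psi\rrbracket$ and $t_i\in\mathcal L_{q_i}(M)$; $\mathcal L(M)=\mathcal L_{q_0}(M)$. The size $|M|$ is the number of symbols in a description of $M$, that is $1+|Q|+|F|$ plus four for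 each transition. Let $\psi_1,\dots,\psi_m$ be the distinct predicates on the transitions of $M$, let $\phi_1,\dots,\phi_k\in\Psi$, and let $L_1,\dots,L_m$ be distinct propositional formulas in letters $S_1,\dots,S_k$ such that $\psi_j$ denotes the same set as the Boolean combination $L_j(\phi_1,\dots,\phi_k)$. Replace each guard $\psi_j$ by $L_j$. The set $M(L_1,\dots,L_m)$ of tree tables consists of the $\{0,1\}^k$-trees accepted when a transition labelled $L_j$ may read every $\beta\in\{0,1\}^k$ with $\beta\models L_j$; the set $M_S(L_1,\dots,L_m)$ of symbolic tables consists of the trees over $\{L_1,\dots,L_m\}$ accepted when the $L_j$ themselves are read as letters. The Parikh image of $M_S(L_1,\dots,L_m)$ is the set of vectors $(|t|_{L_1},\dots,|t|_{L_m})$, $t\in M_S(L_1,\dots,L_m)$, of numbers of occurrences of the letters. For subsets $S_1,\dots,S_k$ of a finite set $U$ of indices and $\beta\in\{0,1\}^k$ put $p_\beta=U\cap\bigcap_{i=1}^k S_i^{\beta_i}$, where $S^1=S$ and $S^0=U\setminus S$, and $p_L=\bigcup_{\beta\models L}p_\beta$. Let $\phi^\beta(d)=\bigwedge_{i=1}^k\phi_i^{\beta_i}(d)$,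 where $\phi^1=\phi$ and $\phi^0=\neg\phi$. **Theorem.** $\mathcal L(M)\neq\emptyset$ holds if and only if the following formula (A) is true: $$\exists S_1,\dots,S_k\subseteq\{0,1\}^*.\ \exists d.\ \bigwedge_{i=1}^k S_i=\{n\mid\phi_i(d(n))\}\ \wedge\ \exists\tau\in M(L_1,\dots,L_m).\ \mathrm{dom}\,\tau=\mathrm{dom}\,d\ \wedge\ \bigwedge_{i=1}^k S_i=\{n\mid\tau_i(n)=1\},$$ where $d$ ranges over $\mathcal D$-trees and $n$ over the positions of the respective tree. The Parikh image of $M_S(L_1,\dots,L_m)$ is defined by an existential Presburger formula $\rho$ of size at most $C\,|M|$, where $C$ is an absolute constant. For every existential Presburger formula $\rho$ that defines this Parikh image, (A) is equivalent to $$\begin{aligned}&\exists s\in\{0,\dots,m\}.\ \exists\sigma:\{1,\dots,s\}\hookrightarrow\{1,\dots,m\}.\ \exists\beta_1,\dots,\beta_s\in\{0,1\}^k.\ \bigwedge_{j=1}^s\exists d\in\mathcal D.\ \phi^{\beta_j}(d)\ \wedge\\&\exists k_1,\dots,k_m\in\mathbb N.\ \exists U\subseteq\{0,1\}^*\text{ finite}.\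 \exists S_1,\dots,S_k,P_1,\dots,P_s\subseteq U.\\&\quad\rho(k_1,\dots,k_m)\ \wedge\bigwedge_{i\notin\mathrm{im}\,\sigma}k_i=0\ \wedge\bigwedge_{i=1}^sP_i\subseteq p_{L_{\sigma(i)}}\ \wedge\ \bigcup_{i=1}^mp_{L_i}=\dot\bigcup_{i=1}^sP_i\ \wedge\\&\quad\bigwedge_{i=1}^s|P_i|=k_{\sigma(i)}\ \wedge\bigwedge_{i=1}^sp_{\beta_i}\cap P_i\neq\emptyset .\end{aligned}$$ Here $\dot\bigcup$ denotes a union of pairwise disjoint sets. -/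

import Mathlib

open FirstOrder

/-- An effective Boolean algebra with domain `D` and predicates `Ψ`. The predicates are
finitely represented objects (`Primcodable`), and satisfiability of a predicate is decidable. -/
structure EffectiveBooleanAlgebra (D : Type*) (Ψ : Type*) [Primcodable Ψ] where
  denote : Ψ → Set D
  bot : Ψ
  top : Ψ
  or : Ψ → Ψ → Ψ
  and : Ψ → Ψ → Ψ
  neg : Ψ → Ψ
  denote_bot : denote bot = ∅
  denote_top : denote top = Set.univ
  denote_or : ∀ a b, denote (or a b) = denote a ∪ denote b
  denote_and : ∀ a b, denote (and a b) = denote a ∩ denote b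
  denote_neg : ∀ a, denote (neg a) = (denote a)ᶜ
  decidable_nonempty : ComputablePred fun a => (denote a).Nonempty

/-- Propositional formulas in the letters `S_1, …, S_k`. -/
inductive PropFormula (k : ℕ) : Type
  | letter : Fin k → PropFormula k
  | bot : PropFormula k
  | top : PropFormula k
  | or : PropFormula k → PropFormula k → PropFormula k
  | and : PropFormula k → PropFormula k → PropFormula k
  | neg : PropFormula k → PropFormula k

namespace PropFormula

/-- The satisfaction relation `β ⊨ L` for an assignment `β ∈ {0,1}^k`. -/
def Sat {k : ℕ} (β : Fin k → Bool) : PropFormula k → Prop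
  | letter i => β i = true
  | bot => False
  | top => True
  | or a b => Sat β a ∨ Sat β b
  | and a b => Sat β a ∧ Sat β b
  | neg a => ¬ Sat β a

/-- The Boolean combination of the predicates `φ_1, …, φ_k` described by a propositional formula. -/
def inst {D Ψ : Type*} [Primcodable Ψ] (A : EffectiveBooleanAlgebra D Ψ) {k : ℕ}
    (φ : Fin k → Ψ) : PropFormula k → Ψ
  | letter i => φ i
  | bot => A.bot
  | top => A.top
  | or a b => A.or (inst A φ a) (inst A φ b)
  | and a b => A.and (inst A φ a) (inst A φ b)
  | neg a => A.neg (inst A φ a)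

end PropFormula

/-- Binary `X`-trees: functions from a finite subset of `{0,1}^*` closed under initial segments
to `X`. The function is given as a partial function on words over `Bool` (`false` is the
letter 0, `true` is the letter 1); its domain is the set of words where it is not `none`. -/
@[ext] structure BinTree (X : Type*) where
  label : List Bool → Option X
  finite_dom : {n | ∃ x, label n = some x}.Finite
  prefix_closed : ∀ u v, (∃ x, label (u ++ v) = some x) → ∃ x, label u = some x

namespace BinTree

variable {X : Type*}

/-- The domain of a tree. -/
def dom (t : BinTree X) : Set (List Bool) := {n | ∃ x, t.label n = some x}

/-- The empty tree `Λ`. -/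
def empty : BinTree X where
  label _ := none
  finite_dom := by simp
  prefix_closed := by simp

/-- The labelling function of `x[t₀, t₁]`. -/
def nodeLabel (x : X) (t₀ t₁ : BinTree X) : List Bool → Option X
  | [] => some x
  | false :: n => t₀.label n
  | true :: n => t₁.label n

/-- The tree `x[t₀, t₁]` with root label `x`, left subtree `t₀` and right subtree `t₁`. -/
def node (x : X) (t₀ t₁ : BinTree X) : BinTree X where
  label := nodeLabel x t₀ t₁
  finite_dom := by
    refine (((Set.finite_singleton []).union (t₀.finite_dom.image (List.cons false))).union
      (t₁.finite_dom.image (List.cons true))).subset ?_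
    rintro (_ | ⟨_ | _, n⟩) h
    · simp
    · exact Or.inl (Or.inr ⟨n, h, rfl⟩)
    · exact Or.inr ⟨n, h, rfl⟩
  prefix_closed := by
    rintro (_ | ⟨_ | _, u⟩) v h
    · exact ⟨x, rfl⟩
    · exact t₀.prefix_closed u v h
    · exact t₁.prefix_closed u v h

/-- The number of positions of a tree that carry the label `x`. -/
noncomputable def count (t : BinTree X) (x : X) : ℕ := {n | t.label n = some x}.ncard

end BinTree

/-- Tree automata with states `Q` whose transitions `(q₁, γ, q₂, q₃)`, with sources `q₁`, `q₂`
and target `q₃`, carry guards `γ` from `Γ`. -/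
structure TreeAutomaton (Q Γ : Type*) where
  init : Q
  final : Set Q
  trans : Set (Q × Γ × Q × Q)
  finite_states : Finite Q
  finite_trans : trans.Finite

namespace TreeAutomaton

variable {Q Γ X : Type*}

/-- `M.AcceptsAt sem q t`: the tree `t` belongs to the language of `M` at the state `q`, when a
guard `γ` may read exactly the characters in `sem γ`. -/
inductive AcceptsAt (M : TreeAutomaton Q Γ) (sem : Γ → Set X) : Q → BinTree X → Prop
  | empty {q : Q} (hq : q ∈ M.final) : AcceptsAt M sem q BinTree.empty
  | node {q₁ q₂ q₃ : Q} {γ : Γ} {x : X} {t₁ t₂ : BinTree X}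
      (hΔ : (q₁, γ, q₂, q₃) ∈ M.trans) (hx : x ∈ sem γ)
      (h₁ : AcceptsAt M sem q₁ t₁) (h₂ : AcceptsAt M sem q₂ t₂) :
      AcceptsAt M sem q₃ (BinTree.node x t₁ t₂)

/-- The language at the initial state. -/
def lang (M : TreeAutomaton Q Γ) (sem : Γ → Set X) : Set (BinTree X) :=
  {t | M.AcceptsAt sem M.init t}

/-- The guards that occur on transitions. -/
def guards (M : TreeAutomaton Q Γ) : Set Γ := {γ | ∃ q₁ q₂ q₃, (q₁, γ, q₂, q₃) ∈ M.trans}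

/-- The number of symbols in a description of the automaton: the initial state, the list of
states, the list of final states, and four symbols for each transition. -/
noncomputable def size (M : TreeAutomaton Q Γ) : ℕ :=
  1 + Nat.card Q + M.final.ncard + 4 * M.trans.ncard

/-- The automaton obtained by replacing each guard `ψ_j` by the label `L_j`. -/
def relabel {Γ' : Type*} {m : ℕ} (M : TreeAutomaton Q Γ) (ψ : Fin m → Γ) (L : Fin m → Γ') :
    TreeAutomaton Q Γ' where
  init := M.init
  final := M.final
  trans := {t | ∃ j, t.2.1 = L j ∧ (t.1, ψ j, t.2.2) ∈ M.trans}
  finite_states := M.finite_states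
  finite_trans := by
    refine ((M.finite_trans.prod (Set.finite_range L)).image
      (fun p => (p.1.1, p.2, p.1.2.2))).subset ?_
    rintro ⟨q, γ, r⟩ ⟨j, h, hj⟩
    exact ⟨((q, ψ j, r), L j), ⟨hj, j, rfl⟩, by simp at h; simp [h]⟩

/-- The set `M(L_1, …, L_m)` of tree tables: bit-string trees accepted by the automaton
relabelled with propositional formulas. -/
def tables {k m : ℕ} (M : TreeAutomaton Q Γ) (ψ : Fin m → Γ) (L : Fin m → PropFormula k) :
    Set (BinTree (Fin k → Bool)) :=
  (M.relabel ψ L).lang fun F => {β | F.Sat β}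

/-- The set `M_S(L_1, …, L_m)` of symbolic tables: the relabelled automaton reads the
propositional formulas themselves as letters. -/
def symbolicTables {k m : ℕ} (M : TreeAutomaton Q Γ) (ψ : Fin m → Γ) (L : Fin m → PropFormula k) :
    Set (BinTree (PropFormula k)) :=
  (M.relabel ψ L).lang fun F => {F}

/-- The Parikh image of `M_S(L_1, …, L_m)`. -/
def parikh {k m : ℕ} (M : TreeAutomaton Q Γ) (ψ : Fin m → Γ) (L : Fin m → PropFormula k) :
    Set (Fin m → ℕ) :=
  {v | ∃ t ∈ M.symbolicTables ψ L, ∀ i, v i = t.count (L i)}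

end TreeAutomaton

/-- A symbolic tree automaton over the effective Boolean algebra `A`, with set of states `Q`. -/
abbrev SymbolicTreeAutomaton {D Ψ : Type*} [Primcodable Ψ] (_A : EffectiveBooleanAlgebra D Ψ)
    (Q : Type*) := TreeAutomaton Q Ψ

namespace SymbolicTreeAutomaton

variable {D Ψ Q : Type*} [Primcodable Ψ] (A : EffectiveBooleanAlgebra D Ψ) {k m : ℕ}

/-- The language `𝓛(M)` of a symbolic tree automaton. -/
def language (M : SymbolicTreeAutomaton A Q) : Set (BinTree D) := TreeAutomaton.lang M A.denote

/-- `ψ_1, …, ψ_m` lists without repetition the predicates on the transitions of `M`, and the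
pairwise distinct propositional formulas `L_1, …, L_m` express them through `φ_1, …, φ_k`. -/
structure Presentation (M : SymbolicTreeAutomaton A Q) (φ : Fin k → Ψ) (ψ : Fin m → Ψ)
    (L : Fin m → PropFormula k) : Prop where
  guard_injective : Function.Injective ψ
  range_guard : Set.range ψ = TreeAutomaton.guards M
  formula_injective : Function.Injective L
  denote_guard : ∀ j, A.denote (ψ j) = A.denote ((L j).inst A φ)

/-- There are sets `S_1, …, S_k`, a tree `d` of characters and a tree table `τ` with the same
positions such that `S_i = {n | φ_i(d(n))}` and `S_i = {n | τ_i(n)}`. -/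
def TablePower (M : SymbolicTreeAutomaton A Q) (φ : Fin k → Ψ) (ψ : Fin m → Ψ)
    (L : Fin m → PropFormula k) : Prop :=
  ∃ (S : Fin k → Set (List Bool)) (d : BinTree D),
    (∀ i, S i = {n | ∃ x, d.label n = some x ∧ x ∈ A.denote (φ i)}) ∧
    ∃ τ ∈ TreeAutomaton.tables M ψ L, τ.dom = d.dom ∧
      ∀ i, S i = {n | ∃ β, τ.label n = some β ∧ β i = true}

end SymbolicTreeAutomaton

/-- The formula `φ^β(d) = ⋀ i, φ_i^{β(i)}(d)`. -/
def RegionFormula {D Ψ : Type*} [Primcodable Ψ] (A : EffectiveBooleanAlgebra D Ψ) {k : ℕ}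
    (φ : Fin k → Ψ) (β : Fin k → Bool) (d : D) : Prop :=
  ∀ i, d ∈ (if β i then A.denote (φ i) else (A.denote (φ i))ᶜ)

/-- The elementary Venn region `p_β = ⋂ i, S_i^{β_i}`, complements being taken in the index
set `U`. -/
def vennRegion {I : Type*} {k : ℕ} (U : Set I) (S : Fin k → Set I) (β : Fin k → Bool) : Set I :=
  U ∩ ⋂ i, (if β i then S i else U \ S i)

/-- The region `p_L`, the union of the elementary regions `p_β` with `β ⊨ L`. -/
def formulaRegion {I : Type*} {k : ℕ} (U : Set I) (S : Fin k → Set I) (F : PropFormula k) :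
    Set I :=
  ⋃ β ∈ {β : Fin k → Bool | F.Sat β}, vennRegion U S β

/-- The number of symbols of a first-order term. -/
def termSize {𝓛 : Language} {α : Type*} : 𝓛.Term α → ℕ
  | .var _ => 1
  | .func _ ts => 1 + ∑ i, termSize (ts i)

/-- The number of symbols of a first-order formula. -/
def formulaSize {𝓛 : Language} {α : Type*} : {n : ℕ} → 𝓛.BoundedFormula α n → ℕ
  | _, .falsum => 1
  | _, .equal t u => 1 + termSize t + termSize u
  | _, .rel _ ts => 1 + ∑ i, termSize (ts i)
  | _, .imp a b => 1 + formulaSize a + formulaSize b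
  | _, .all a => 1 + formulaSize a

/-- Existential formulas: a block of existential quantifiers before a quantifier-free formula. -/
def IsExistentialFormula {𝓛 : Language} {α : Type*} (ρ : 𝓛.Formula α) : Prop :=
  ∃ (n : ℕ) (θ : 𝓛.BoundedFormula α n), θ.IsQF ∧ ρ = θ.exs

/-- `ρ` is an existential Presburger formula that defines the set `V`. -/
def DefinesExistentially {m : ℕ} (ρ : Language.presburger.Formula (Fin m))
    (V : Set (Fin m → ℕ)) : Prop :=
  IsExistentialFormula ρ ∧ ∀ v : Fin m → ℕ, ρ.Realize v ↔ v ∈ V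

/-- The formula that first guesses `s`, `σ` and `β_1, …, β_s`, and combines existential sentences
on characters with constraints on subsets of a finite index set `U`. -/
def ElimProp {D Ψ : Type*} [Primcodable Ψ] (A : EffectiveBooleanAlgebra D Ψ) {k m : ℕ}
    (φ : Fin k → Ψ) (L : Fin m → PropFormula k)
    (ρ : Language.presburger.Formula (Fin m)) : Prop :=
  ∃ s ≤ m, ∃ (σ : Fin s ↪ Fin m) (β : Fin s → Fin k → Bool),
    (∀ j, ∃ d, RegionFormula A φ (β j) d) ∧
    ∃ (c : Fin m → ℕ) (U : Set (List Bool)) (S : Fin k → Set (List Bool))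
      (P : Fin s → Set (List Bool)),
      U.Finite ∧ (∀ i, S i ⊆ U) ∧ (∀ i, P i ⊆ U) ∧
      ρ.Realize c ∧
      (∀ i, i ∉ Set.range σ → c i = 0) ∧
      (∀ i, P i ⊆ formulaRegion U S (L (σ i))) ∧
      (⋃ i, formulaRegion U S (L i)) = ⋃ i, P i ∧
      Pairwise (fun i j => Disjoint (P i) (P j)) ∧
      (∀ i, (P i).encard = c (σ i)) ∧
      ∀ i, (vennRegion U S (β i) ∩ P i).Nonempty

/-!
The proof has three parts.

*Characters and tables.* All equivalences between nonemptiness, the formula (A) and the guessing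
formula come from one principle, `TreeAutomaton.AcceptsAt.transfer`: acceptance carries over along
a relation between characters that is compatible with the guards. A tree of characters is turned
into its tree table by recording which `φ_i` hold, and a table is turned back because it decides
every guard. A table accepted by a run gives the symbolic table of the guards used
(`TreeAutomaton.AcceptsAt.exists_guards`); the guards that occur are listed by `σ`, their positions
are the sets `P_i`, and `β_i` is the bit string at one such position. Conversely, a vector of counts
satisfying `ρ` comes from a symbolic table in which only guards in the range of `σ` occur, and a
character in the region `β_i` satisfies the guard `L_{σ i}`, since `p_{β_i}` meets `P_i ⊆ p_{L_{σ i}}`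
(`sat_of_mem_regions`); so these characters can be substituted for the guards.

*Parikh images.* A multiset `y` of transitions is the multiset of transitions of a run with root
state `q₀` if and only if it is balanced (each state is produced from above as often as it is
expanded by a transition or, if final, closed by the empty tree) and connected (each expanded state
is reachable from `q₀` through `y`). For sufficiency (`TreeAutomaton.Forest.of_balanced`) the run is
built from the root like an Eulerian trail in Fleury's algorithm: at an open state `q`, a transition
is used after which `q`, if it has to be expanded again, is still reachable
(`TreeAutomaton.exists_transition_keeping_reach`).

*The formula.* Balance is one linear equation per state. Connectedness is expressed with a distance
`z q` from `q₀`: each expanded state other than `q₀` is a source of a used transition whose target is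
one step closer. Each transition occurs in a bounded number of the equations, so the formula has
linear size (`TreeAutomaton.exists_presburger_parikhEquations`).
-/

/-! ### Trees -/

namespace BinTree

variable {X Y : Type*}

/-- The tree with the same positions whose labels are the images of the labels under `f`. -/
def map (f : X → Y) (t : BinTree X) : BinTree Y where
  label n := (t.label n).map f
  finite_dom := by simpa using t.finite_dom
  prefix_closed u v h := by
    have h' : ∃ x, t.label (u ++ v) = some x := by
      obtain ⟨y, hy⟩ := h
      obtain ⟨x, hx, -⟩ := Option.map_eq_some_iff.1 hy
      exact ⟨x, hx⟩
    obtain ⟨x, hx⟩ := t.prefix_closed u v h'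
    exact ⟨f x, by simp [hx]⟩

theorem dom_map (f : X → Y) (t : BinTree X) : (t.map f).dom = t.dom := by
  ext n
  simp [dom, map]

/-- The subtree at the child `b` of the root; it is empty if this child does not exist. -/
def child (t : BinTree X) (b : Bool) : BinTree X where
  label n := t.label (b :: n)
  finite_dom := Set.Finite.preimage (f := List.cons b) List.cons_injective.injOn t.finite_dom
  prefix_closed u v h := t.prefix_closed (b :: u) v h

theorem eq_node_of_label_nil {t : BinTree X} {x : X} (h : t.label [] = some x) :
    t = node x (t.child false) (t.child true) := by
  ext1
  funext n
  rcases n with _ | ⟨_ | _, n⟩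
  · exact h
  · rfl
  · rfl

theorem eq_empty_of_label_nil {t : BinTree X} (h : t.label [] = none) : t = empty := by
  ext1
  funext n
  refine Option.eq_none_iff_forall_ne_some.2 fun x hx => ?_
  obtain ⟨y, hy⟩ := t.prefix_closed [] n ⟨x, hx⟩
  simp [h] at hy

theorem count_empty (x : X) : (empty : BinTree X).count x = 0 := by
  simp [count, empty]

open scoped Classical in
theorem count_node (x y : X) (t₀ t₁ : BinTree X) :
    (node x t₀ t₁).count y = (if y = x then 1 else 0) + t₀.count y + t₁.count y := by
  have hfin : ∀ t : BinTree X, {n | t.label n = some y}.Finite :=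
    fun t => t.finite_dom.subset fun n hn => ⟨y, hn⟩
  have hset : {n | (node x t₀ t₁).label n = some y} =
      ({n | n = [] ∧ y = x} ∪ List.cons false '' {n | t₀.label n = some y}) ∪
        List.cons true '' {n | t₁.label n = some y} := by
    ext n
    rcases n with _ | ⟨_ | _, n⟩ <;> simp [node, nodeLabel, eq_comm]
  have hroot : {n : List Bool | n = [] ∧ y = x}.Finite :=
    (Set.finite_singleton []).subset fun n hn => hn.1
  rw [count, hset, Set.ncard_union_eq _ (hroot.union ((hfin t₀).image _)) ((hfin t₁).image _),
    Set.ncard_union_eq _ hroot ((hfin t₀).image _),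
    Set.ncard_image_of_injective _ List.cons_injective,
    Set.ncard_image_of_injective _ List.cons_injective]
  · congr 2
    by_cases h : y = x <;> simp [h]
  · rw [Set.disjoint_left]
    rintro n ⟨rfl, -⟩ ⟨n', -, h⟩
    simp at h
  · rw [Set.disjoint_left]
    rintro n (⟨rfl, -⟩ | ⟨n', -, rfl⟩) ⟨n'', -, h⟩ <;> simp at h

theorem count_pos_iff {t : BinTree X} {x : X} : 0 < t.count x ↔ ∃ n, t.label n = some x :=
  Set.ncard_pos (t.finite_dom.subset fun _ hn => ⟨x, hn⟩)

end BinTree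

/-! ### Transfer of acceptance between automata -/

namespace TreeAutomaton

variable {Q Γ Γ' X Y : Type*}

/-- Acceptance is transferred along a relation `r` between characters, if each transition of `M`
that may read `x` is matched by a transition of `M'` between the same states that may read every
character related to `x`. -/
theorem AcceptsAt.transfer {M : TreeAutomaton Q Γ} {M' : TreeAutomaton Q Γ'} {sem : Γ → Set X}
    {sem' : Γ' → Set Y} {r : X → Y → Prop} (hfinal : M.final ⊆ M'.final)
    (htrans : ∀ {q₁ γ q₂ q₃ x y}, (q₁, γ, q₂, q₃) ∈ M.trans → x ∈ sem γ → r x y →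
      ∃ γ', (q₁, γ', q₂, q₃) ∈ M'.trans ∧ y ∈ sem' γ')
    {q : Q} {t : BinTree X} (h : M.AcceptsAt sem q t) {t' : BinTree Y}
    (hr : ∀ n, Option.Rel r (t.label n) (t'.label n)) : M'.AcceptsAt sem' q t' := by
  induction h generalizing t' with
  | empty hq =>
    have h0 : t'.label [] = none := by
      have h0 : Option.Rel r none (t'.label []) := hr []
      generalize t'.label [] = o at h0
      cases h0
      rfl
    rw [BinTree.eq_empty_of_label_nil h0]
    exact .empty (hfinal hq)
  | @node q₁ q₂ q₃ γ x t₁ t₂ hΔ hx h₁ h₂ ih₁ ih₂ =>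
    have h0 : Option.Rel r (some x) (t'.label []) := hr []
    obtain ⟨y, hy, hxy⟩ : ∃ y, t'.label [] = some y ∧ r x y := by
      generalize t'.label [] = o at h0
      cases h0 with
      | some h => exact ⟨_, rfl, h⟩
    rw [BinTree.eq_node_of_label_nil hy]
    obtain ⟨γ', hΔ', hy'⟩ := htrans hΔ hx hxy
    exact .node hΔ' hy' (ih₁ fun n => hr (false :: n)) (ih₂ fun n => hr (true :: n))

/-- Every accepted tree has a tree of guards that records an accepting run on it. -/
theorem AcceptsAt.exists_guards {M : TreeAutomaton Q Γ} {sem : Γ → Set X} {q : Q} {t : BinTree X}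
    (h : M.AcceptsAt sem q t) :
    ∃ T : BinTree Γ, M.AcceptsAt (fun γ => {γ}) q T ∧
      ∀ n, Option.Rel (fun γ x => γ ∈ M.guards ∧ x ∈ sem γ) (T.label n) (t.label n) := by
  induction h with
  | empty hq => exact ⟨.empty, .empty hq, fun n => .none⟩
  | @node q₁ q₂ q₃ γ x t₁ t₂ hΔ hx h₁ h₂ ih₁ ih₂ =>
    obtain ⟨T₁, hT₁, hr₁⟩ := ih₁
    obtain ⟨T₂, hT₂, hr₂⟩ := ih₂
    refine ⟨.node γ T₁ T₂, .node hΔ rfl hT₁ hT₂, ?_⟩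
    rintro (_ | ⟨_ | _, n⟩)
    · exact .some ⟨⟨q₁, q₂, q₃, hΔ⟩, hx⟩
    · exact hr₁ n
    · exact hr₂ n

/-- The guards on a run can be replaced by characters, if each guard that occurs may read one. -/
theorem AcceptsAt.exists_of_guards {M : TreeAutomaton Q Γ} {sem : Γ → Set X} {q : Q}
    {T : BinTree Γ} (h : M.AcceptsAt (fun γ => {γ}) q T)
    (hne : ∀ n γ, γ ∈ M.guards → T.label n = some γ → (sem γ).Nonempty) :
    ∃ t : BinTree X, M.AcceptsAt sem q t := by
  induction h with
  | empty hq => exact ⟨.empty, .empty hq⟩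
  | @node q₁ q₂ q₃ γ x t₁ t₂ hΔ hx h₁ h₂ ih₁ ih₂ =>
    obtain ⟨d₁, hd₁⟩ := ih₁ fun n => hne (false :: n)
    obtain ⟨d₂, hd₂⟩ := ih₂ fun n => hne (true :: n)
    obtain ⟨c, hc⟩ := hne [] γ ⟨q₁, q₂, q₃, hΔ⟩ (congrArg some hx)
    exact ⟨_, .node hΔ hc hd₁ hd₂⟩

theorem guards_relabel_subset {m : ℕ} (M : TreeAutomaton Q Γ) (ψ : Fin m → Γ) (L : Fin m → Γ') :
    (M.relabel ψ L).guards ⊆ Set.range L := by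
  rintro _ ⟨q₁, q₂, q₃, j, h, -⟩
  exact ⟨j, h.symm⟩

end TreeAutomaton

/-! ### Symbolic automata and tree tables -/

theorem PropFormula.mem_denote_inst {D Ψ : Type*} [Primcodable Ψ]
    (A : EffectiveBooleanAlgebra D Ψ) {k : ℕ} (φ : Fin k → Ψ) {β : Fin k → Bool} {d : D}
    (hβ : ∀ i, β i = true ↔ d ∈ A.denote (φ i)) (F : PropFormula k) :
    d ∈ A.denote (F.inst A φ) ↔ F.Sat β := by
  induction F with
  | letter i => exact (hβ i).symm
  | bot => simp [inst, Sat, A.denote_bot]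
  | top => simp [inst, Sat, A.denote_top]
  | or a b iha ihb => simp [inst, Sat, A.denote_or, iha, ihb]
  | and a b iha ihb => simp [inst, Sat, A.denote_and, iha, ihb]
  | neg a iha => simp [inst, Sat, A.denote_neg, iha]

theorem regionFormula_iff {D Ψ : Type*} [Primcodable Ψ] (A : EffectiveBooleanAlgebra D Ψ) {k : ℕ}
    (φ : Fin k → Ψ) (β : Fin k → Bool) (d : D) :
    RegionFormula A φ β d ↔ ∀ i, β i = true ↔ d ∈ A.denote (φ i) := by
  refine forall_congr' fun i => ?_
  cases h : β i <;> simp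

section VennRegion

variable {I : Type*} {k : ℕ} {U : Set I} {S : Fin k → Set I}

theorem mem_vennRegion_iff {β : Fin k → Bool} {n : I} :
    n ∈ vennRegion U S β ↔ n ∈ U ∧ ∀ i, β i = true ↔ n ∈ S i := by
  simp only [vennRegion, Set.mem_inter_iff, Set.mem_iInter]
  refine and_congr_right fun hn => forall_congr' fun i => ?_
  cases h : β i <;> simp [hn]

theorem mem_formulaRegion_iff {F : PropFormula k} {n : I} :
    n ∈ formulaRegion U S F ↔ ∃ β, F.Sat β ∧ n ∈ vennRegion U S β := by
  simp [formulaRegion]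

/-- A position lies in at most one elementary region, so that the region decides which of the
formula regions contain the position. -/
theorem sat_of_mem_regions {β : Fin k → Bool} {F : PropFormula k} {n : I}
    (hβ : n ∈ vennRegion U S β) (hF : n ∈ formulaRegion U S F) : F.Sat β := by
  obtain ⟨β', hs, hβ'⟩ := mem_formulaRegion_iff.1 hF
  have : β = β' := funext fun i => Bool.eq_iff_iff.2 <|
    ((mem_vennRegion_iff.1 hβ).2 i).trans ((mem_vennRegion_iff.1 hβ').2 i).symm
  rwa [this]

end VennRegion

namespace SymbolicTreeAutomaton

variable {D Ψ Q : Type*} [Primcodable Ψ] {A : EffectiveBooleanAlgebra D Ψ}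
  {M : SymbolicTreeAutomaton A Q} {k m : ℕ} {φ : Fin k → Ψ} {ψ : Fin m → Ψ}
  {L : Fin m → PropFormula k}

/-- The tree table of a tree of characters records which of the predicates `φ_i` hold. -/
theorem language_nonempty_iff_tablePower (hP : Presentation A M φ ψ L) :
    (language A M).Nonempty ↔ TablePower A M φ ψ L := by
  classical
  constructor
  · rintro ⟨d, hd⟩
    refine ⟨_, d, fun i => rfl, d.map fun x i => decide (x ∈ A.denote (φ i)), ?_,
      d.dom_map _, fun i => ?_⟩
    · change TreeAutomaton.AcceptsAt (TreeAutomaton.relabel M ψ L) _ (TreeAutomaton.init M) _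
      refine TreeAutomaton.AcceptsAt.transfer (M := M) (M' := TreeAutomaton.relabel M ψ L)
        (r := fun x β => β = fun i => decide (x ∈ A.denote (φ i))) subset_rfl ?_ hd fun n => ?_
      · rintro q₁ γ q₂ q₃ x _ hΔ hx rfl
        obtain ⟨j, rfl⟩ : γ ∈ Set.range ψ := hP.range_guard ▸ ⟨q₁, q₂, q₃, hΔ⟩
        refine ⟨L j, ⟨j, rfl, hΔ⟩, ?_⟩
        rw [hP.denote_guard] at hx
        exact (PropFormula.mem_denote_inst A φ (by simp) (L j)).1 hx
      · change Option.Rel _ (d.label n) ((d.label n).map _)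
        cases d.label n with
        | none => exact .none
        | some x => exact .some rfl
    · ext n
      simp [BinTree.map]
  · rintro ⟨S, d, hS, τ, hτ, hdom, hS'⟩
    refine ⟨d, ?_⟩
    change TreeAutomaton.AcceptsAt M A.denote (TreeAutomaton.init M) d
    refine TreeAutomaton.AcceptsAt.transfer (M := TreeAutomaton.relabel M ψ L) (M' := M)
      (r := fun β x => ∀ i, β i = true ↔ x ∈ A.denote (φ i)) subset_rfl ?_ hτ fun n => ?_
    · rintro q₁ _ q₂ q₃ β x ⟨j, rfl, hΔ⟩ hβ hr
      refine ⟨ψ j, hΔ, ?_⟩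
      rw [hP.denote_guard]
      exact (PropFormula.mem_denote_inst A φ hr (L j)).2 hβ
    · have hn : n ∈ τ.dom ↔ n ∈ d.dom := by rw [hdom]
      have hSn : ∀ i, (∃ x, d.label n = some x ∧ x ∈ A.denote (φ i)) ↔
          ∃ β, τ.label n = some β ∧ β i = true := fun i =>
        (Set.ext_iff.1 (hS i) n).symm.trans (Set.ext_iff.1 (hS' i) n)
      simp only [BinTree.dom, Set.mem_ofPred_eq] at hn
      cases hd : d.label n <;> cases ht : τ.label n <;> simp [hd, ht] at hn hSn ⊢
      exact fun i => (hSn i).symm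

/-- From left to right, `σ` lists the letters that occur in a symbolic table for `τ`, and `U` is the
set of positions. From right to left, the sets `S_i` and `P_i` serve only to show that the region
`β_j` satisfies `L_{σ j}`: the witnesses for the regions `β_j` are substituted for the letters of a
symbolic table with the letter counts `c`, in which no letter outside the range of `σ` occurs. -/
theorem tablePower_iff_elimProp (hP : Presentation A M φ ψ L)
    {ρ : Language.presburger.Formula (Fin m)}
    (hρ : ∀ v : Fin m → ℕ, ρ.Realize v ↔ v ∈ TreeAutomaton.parikh M ψ L) :
    TablePower A M φ ψ L ↔ ElimProp A φ L ρ := by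
  classical
  constructor
  · rintro ⟨S, d, hS, τ, hτ, hdom, hS'⟩
    obtain ⟨T, hT, hr⟩ := TreeAutomaton.AcceptsAt.exists_guards hτ
    -- At a position of the trees, all three labels exist and fit together.
    have hlab : ∀ n ∈ d.dom, ∃ j x β, T.label n = some (L j) ∧ d.label n = some x ∧
        τ.label n = some β ∧ (L j).Sat β ∧ (∀ i, β i = true ↔ x ∈ A.denote (φ i)) ∧
        n ∈ vennRegion d.dom S β := by
      intro n hn
      obtain ⟨x, hx⟩ := hn
      obtain ⟨β, hβ⟩ : n ∈ τ.dom := hdom ▸ ⟨x, hx⟩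
      have h := hr n
      rw [hβ] at h
      generalize hF : T.label n = o at h
      cases h with
      | @some F _ h =>
        obtain ⟨j, rfl⟩ := TreeAutomaton.guards_relabel_subset _ _ _ h.1
        refine ⟨j, x, β, rfl, hx, hβ, h.2, fun i => ?_, mem_vennRegion_iff.2 ⟨⟨x, hx⟩, fun i => ?_⟩⟩
        · have := (Set.ext_iff.1 (hS i) n).symm.trans (Set.ext_iff.1 (hS' i) n)
          simpa [hx, hβ, iff_comm] using this
        · rw [hS' i]
          simp [hβ]
    have hTdom : ∀ n F, T.label n = some F → n ∈ d.dom := by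
      intro n F hF
      have h := hr n
      rw [hF] at h
      generalize hβ : τ.label n = o at h
      cases h with
      | some _ => exact hdom ▸ ⟨_, hβ⟩
    let J : Finset (Fin m) := {i | 0 < T.count (L i)}
    have hJ : ∀ i, i ∈ J ↔ ∃ n, T.label n = some (L i) := fun i => by
      simp [J, BinTree.count_pos_iff]
    let e : Fin J.card ≃ J := J.equivFin.symm
    have hex : ∀ j : Fin J.card, ∃ β : Fin k → Bool, (∃ x, RegionFormula A φ β x) ∧
        ∃ n, n ∈ vennRegion d.dom S β ∧ T.label n = some (L (e j)) := by
      intro j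
      obtain ⟨n, hn⟩ := (hJ _).1 (e j).2
      obtain ⟨j', x, β, h1, h2, h3, h4, h5, h6⟩ := hlab n (hTdom n _ hn)
      exact ⟨β, ⟨x, (regionFormula_iff A φ β x).2 h5⟩, n, h6, hn⟩
    choose β hβ₁ hβ₂ using hex
    refine ⟨J.card, by simpa using J.card_le_univ, e.toEmbedding.trans (.subtype _), β, hβ₁,
      fun i => T.count (L i), d.dom, S, fun j => {n | T.label n = some (L (e j))},
      d.finite_dom, fun i n hn => ?_, fun j n hn => hTdom n _ hn, ?_, fun i hi => ?_,
      fun j n hn => ?_, ?_, fun i j hij => ?_, fun j => ?_, fun j => ?_⟩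
    · rw [hS i] at hn
      exact ⟨hn.choose, hn.choose_spec.1⟩
    · exact (hρ _).2 ⟨T, hT, fun i => rfl⟩
    · by_contra hne
      exact hi ⟨e.symm ⟨i, by simp [J, Nat.pos_of_ne_zero hne]⟩, by simp⟩
    · obtain ⟨j', x, β, h1, h2, h3, h4, h5, h6⟩ := hlab n (hTdom n _ hn)
      have hn' : L j' = L (e j) := Option.some.inj (h1.symm.trans hn)
      exact mem_formulaRegion_iff.2 ⟨β, hn' ▸ h4, h6⟩
    · ext n
      simp only [Set.mem_iUnion, mem_formulaRegion_iff]
      constructor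
      · rintro ⟨i, β, -, hn⟩
        obtain ⟨j, x, β, h1, -⟩ := hlab n (mem_vennRegion_iff.1 hn).1
        exact ⟨e.symm ⟨j, (hJ j).2 ⟨n, h1⟩⟩, by simpa using h1⟩
      · rintro ⟨j, hn⟩
        obtain ⟨j', x, β, h1, h2, h3, h4, h5, h6⟩ := hlab n (hTdom n _ hn)
        exact ⟨j', β, h4, h6⟩
    · refine Set.disjoint_left.2 fun n hi hj => ?_
      have h : L (e i) = L (e j) := Option.some.inj (Eq.trans (Eq.symm hi) hj)
      exact hij (e.injective (Subtype.ext (hP.formula_injective h)))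
    · exact (Set.Finite.cast_ncard_eq (T.finite_dom.subset fun n hn => ⟨_, hn⟩)).symm
    · exact hβ₂ j
  · rintro ⟨s, -, σ, β, hd, c, U, S, P, -, -, -, hc, h0, hPL, -, -, -, hne⟩
    obtain ⟨T, hT, hcount⟩ := (hρ c).1 hc
    refine (language_nonempty_iff_tablePower hP).1 ?_
    obtain ⟨t, ht⟩ := hT.exists_of_guards (sem := fun F => A.denote (F.inst A φ)) <| by
      intro n F hF hn
      obtain ⟨i, rfl⟩ := TreeAutomaton.guards_relabel_subset _ _ _ hF
      have hi : i ∈ Set.range σ := by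
        by_contra hi
        have := h0 i hi
        rw [hcount] at this
        exact (BinTree.count_pos_iff.2 ⟨n, hn⟩).ne' this
      obtain ⟨j, rfl⟩ := hi
      obtain ⟨x, hx⟩ := hd j
      obtain ⟨n', hv, hp⟩ := hne j
      exact ⟨x, (PropFormula.mem_denote_inst A φ ((regionFormula_iff A φ _ x).1 hx) _).2
        (sat_of_mem_regions hv (hPL j hp))⟩
    refine ⟨t, ?_⟩
    change TreeAutomaton.AcceptsAt M A.denote (TreeAutomaton.init M) t
    refine TreeAutomaton.AcceptsAt.transfer (M := TreeAutomaton.relabel M ψ L) (M' := M)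
      (r := Eq) subset_rfl ?_ ht fun n => ?_
    · rintro q₁ _ q₂ q₃ x _ ⟨j, rfl, hΔ⟩ hx rfl
      exact ⟨ψ j, hΔ, by rwa [hP.denote_guard]⟩
    · cases t.label n with
      | none => exact .none
      | some x => exact .some rfl

end SymbolicTreeAutomaton

/-! ### Runs and their multisets of transitions -/

namespace TreeAutomaton

variable {Q Γ : Type*}

/-- The source states of a multiset of transitions, with multiplicities. -/
def sources (y : Multiset (Q × Γ × Q × Q)) : Multiset Q :=
  y.map (fun t => t.1) + y.map (fun t => t.2.2.1)

/-- The target states of a multiset of transitions, with multiplicities. -/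
def targets (y : Multiset (Q × Γ × Q × Q)) : Multiset Q := y.map (fun t => t.2.2.2)

@[simp] theorem sources_zero : sources (0 : Multiset (Q × Γ × Q × Q)) = 0 := rfl

@[simp] theorem targets_zero : targets (0 : Multiset (Q × Γ × Q × Q)) = 0 := rfl

@[simp] theorem sources_cons (t : Q × Γ × Q × Q) (y : Multiset (Q × Γ × Q × Q)) :
    sources (t ::ₘ y) = t.1 ::ₘ t.2.2.1 ::ₘ sources y := by
  simp [sources, Multiset.cons_swap t.1]

@[simp] theorem targets_cons (t : Q × Γ × Q × Q) (y : Multiset (Q × Γ × Q × Q)) :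
    targets (t ::ₘ y) = t.2.2.2 ::ₘ targets y := by
  simp [targets]

@[simp] theorem sources_add (y y' : Multiset (Q × Γ × Q × Q)) :
    sources (y + y') = sources y + sources y' := by
  simp only [sources, Multiset.map_add]
  abel

@[simp] theorem targets_add (y y' : Multiset (Q × Γ × Q × Q)) :
    targets (y + y') = targets y + targets y' := by
  simp [targets]

/-- `M.Run q y`: some run of `M` that ends at the root in the state `q` uses exactly the
transitions in `y`, with multiplicities. -/
inductive Run (M : TreeAutomaton Q Γ) : Q → Multiset (Q × Γ × Q × Q) → Prop
  | empty {q : Q} (hq : q ∈ M.final) : Run M q 0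
  | node {q₁ q₂ q₃ : Q} {γ : Γ} {y₁ y₂ : Multiset (Q × Γ × Q × Q)}
      (hΔ : (q₁, γ, q₂, q₃) ∈ M.trans) (h₁ : Run M q₁ y₁) (h₂ : Run M q₂ y₂) :
      Run M q₃ ((q₁, γ, q₂, q₃) ::ₘ (y₁ + y₂))

open scoped Classical in
theorem Run.exists_acceptsAt {M : TreeAutomaton Q Γ} {q : Q} {y : Multiset (Q × Γ × Q × Q)}
    (h : M.Run q y) : ∃ t : BinTree Γ, M.AcceptsAt (fun γ => {γ}) q t ∧
      ∀ γ, t.count γ = (y.map fun t => t.2.1).count γ := by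
  induction h with
  | empty hq => exact ⟨_, .empty hq, fun γ => by simp [BinTree.count_empty]⟩
  | @node q₁ q₂ q₃ γ y₁ y₂ hΔ h₁ h₂ ih₁ ih₂ =>
    obtain ⟨t₁, ht₁, hc₁⟩ := ih₁
    obtain ⟨t₂, ht₂, hc₂⟩ := ih₂
    refine ⟨_, .node hΔ rfl ht₁ ht₂, fun δ => ?_⟩
    simp only [BinTree.count_node, hc₁, hc₂, Multiset.map_cons, Multiset.map_add,
      Multiset.count_cons, Multiset.count_add]
    omega

open scoped Classical in
theorem AcceptsAt.exists_run {M : TreeAutomaton Q Γ} {q : Q} {t : BinTree Γ}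
    (h : M.AcceptsAt (fun γ => {γ}) q t) : ∃ y, M.Run q y ∧
      ∀ γ, t.count γ = (y.map fun t => t.2.1).count γ := by
  induction h with
  | empty hq => exact ⟨0, .empty hq, fun γ => by simp [BinTree.count_empty]⟩
  | @node q₁ q₂ q₃ γ x t₁ t₂ hΔ hx h₁ h₂ ih₁ ih₂ =>
    obtain ⟨y₁, hy₁, hc₁⟩ := ih₁
    obtain ⟨y₂, hy₂, hc₂⟩ := ih₂
    obtain rfl : x = γ := hx
    refine ⟨_, .node hΔ hy₁ hy₂, fun δ => ?_⟩
    simp only [BinTree.count_node, hc₁, hc₂, Multiset.map_cons, Multiset.map_add,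
      Multiset.count_cons, Multiset.count_add]
    omega

/-- `Reach E R q`: the state `q` can be reached from a state in `R` by going from the targets to
the sources of transitions in `E`, that is, downwards in trees. -/
inductive Reach (E : Set (Q × Γ × Q × Q)) (R : Set Q) : Q → Prop
  | root {q : Q} (hq : q ∈ R) : Reach E R q
  | step {t : Q × Γ × Q × Q} {q : Q} (ht : t ∈ E) (h : Reach E R t.2.2.2)
      (hq : q = t.1 ∨ q = t.2.2.1) : Reach E R q

theorem Reach.trans {E E' : Set (Q × Γ × Q × Q)} {R R' : Set Q} (hE : E ⊆ E')
    (hR : ∀ q ∈ R, Reach E' R' q) {q : Q} (h : Reach E R q) : Reach E' R' q := by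
  induction h with
  | root hq => exact hR _ hq
  | step ht _ hq ih => exact .step (hE ht) ih hq

theorem Reach.mono {E E' : Set (Q × Γ × Q × Q)} {R R' : Set Q} (hE : E ⊆ E') (hR : R ⊆ R')
    {q : Q} (h : Reach E R q) : Reach E' R' q :=
  h.trans hE fun _ hq => .root (hR hq)

/-- The transitions of a run are balanced: each state is entered from above as often as it is left
downwards by a transition or closed by an empty subtree, the latter only at final states. -/
theorem Run.balanced {M : TreeAutomaton Q Γ} {q : Q} {y : Multiset (Q × Γ × Q × Q)}
    (h : M.Run q y) : ∃ W : Multiset Q, (∀ p ∈ W, p ∈ M.final) ∧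
      q ::ₘ sources y = targets y + W := by
  induction h with
  | @empty q hq => exact ⟨{q}, by simpa using hq, by simp⟩
  | @node q₁ q₂ q₃ γ y₁ y₂ hΔ h₁ h₂ ih₁ ih₂ =>
    obtain ⟨W₁, hW₁, hy₁⟩ := ih₁
    obtain ⟨W₂, hW₂, hy₂⟩ := ih₂
    refine ⟨W₁ + W₂, fun p hp => ?_, ?_⟩
    · rcases Multiset.mem_add.1 hp with hp | hp
      exacts [hW₁ p hp, hW₂ p hp]
    · simp only [← Multiset.singleton_add] at hy₁ hy₂
      simp only [sources_cons, targets_cons, sources_add, targets_add]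
      simp only [← Multiset.singleton_add]
      calc {q₃} + ({q₁} + ({q₂} + (sources y₁ + sources y₂)))
          = {q₃} + (({q₁} + sources y₁) + ({q₂} + sources y₂)) := by abel
        _ = _ := by rw [hy₁, hy₂]; abel

theorem Run.subset_trans {M : TreeAutomaton Q Γ} {q : Q} {y : Multiset (Q × Γ × Q × Q)}
    (h : M.Run q y) : ∀ t ∈ y, t ∈ M.trans := by
  induction h with
  | empty hq => simp
  | node hΔ h₁ h₂ ih₁ ih₂ =>
    intro t ht
    simp only [Multiset.mem_cons, Multiset.mem_add] at ht
    rcases ht with rfl | ht | ht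
    exacts [hΔ, ih₁ t ht, ih₂ t ht]

theorem Run.reach {M : TreeAutomaton Q Γ} {q : Q} {y : Multiset (Q × Γ × Q × Q)}
    (h : M.Run q y) : ∀ t ∈ y, Reach {t | t ∈ y} {q} t.2.2.2 := by
  induction h with
  | empty hq => simp
  | @node q₁ q₂ q₃ γ y₁ y₂ hΔ h₁ h₂ ih₁ ih₂ =>
    intro t ht
    have h0 : (q₁, γ, q₂, q₃) ∈ {t | t ∈ (q₁, γ, q₂, q₃) ::ₘ (y₁ + y₂)} :=
      Multiset.mem_cons_self _ _
    simp only [Multiset.mem_cons, Multiset.mem_add] at ht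
    rcases ht with rfl | ht | ht
    · exact .root rfl
    · refine (ih₁ t ht).trans (fun t ht => by simp_all) ?_
      rintro _ rfl
      exact .step h0 (.root rfl) (.inl rfl)
    · refine (ih₂ t ht).trans (fun t ht => by simp_all) ?_
      rintro _ rfl
      exact .step h0 (.root rfl) (.inr rfl)

/-- `M.Forest R y`: there are runs ending in the states in `R`, with multiplicities, that together
use exactly the transitions in `y`. -/
inductive Forest (M : TreeAutomaton Q Γ) : Multiset Q → Multiset (Q × Γ × Q × Q) → Prop
  | zero : Forest M 0 0
  | cons {q : Q} {R : Multiset Q} {y y' : Multiset (Q × Γ × Q × Q)}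
      (h : Run M q y) (h' : Forest M R y') : Forest M (q ::ₘ R) (y + y')

theorem Forest.of_final {M : TreeAutomaton Q Γ} (W : Multiset Q) (hW : ∀ q ∈ W, q ∈ M.final) :
    M.Forest W 0 := by
  induction W using Multiset.induction with
  | empty => exact .zero
  | cons q W ih =>
    have := Forest.cons (.empty (hW q (by simp))) (ih fun p hp => hW p (by simp [hp]))
    simpa using this

theorem Forest.eq_zero {M : TreeAutomaton Q Γ} {R : Multiset Q} {y : Multiset (Q × Γ × Q × Q)}
    (h : M.Forest R y) (hR : R = 0) : y = 0 := by
  cases h with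
  | zero => rfl
  | cons => exact absurd hR (Multiset.cons_ne_zero)

theorem Forest.uncons {M : TreeAutomaton Q Γ} {q : Q} {R : Multiset Q}
    {y : Multiset (Q × Γ × Q × Q)} (h : M.Forest (q ::ₘ R) y) :
    ∃ y₁ y₂, y = y₁ + y₂ ∧ M.Run q y₁ ∧ M.Forest R y₂ := by
  classical
  suffices H : ∀ R', M.Forest R' y → q ∈ R' →
      ∃ y₁ y₂, y = y₁ + y₂ ∧ M.Run q y₁ ∧ M.Forest (R'.erase q) y₂ by
    simpa using H _ h (Multiset.mem_cons_self _ _)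
  intro R' h'
  clear h
  induction h' with
  | zero => simp
  | @cons p R' y y' hp hR' ih =>
    intro hq
    by_cases hpq : p = q
    · subst hpq
      exact ⟨y, y', rfl, hp, by simpa using hR'⟩
    · obtain ⟨y₁, y₂, rfl, h₁, h₂⟩ := ih (by simpa [Ne.symm hpq] using hq)
      refine ⟨y₁, y + y₂, by abel, h₁, ?_⟩
      rw [Multiset.erase_cons_tail _ hpq]
      exact .cons hp h₂

/-- Two trees of a forest can be joined by a transition. -/
theorem Forest.node {M : TreeAutomaton Q Γ} {t : Q × Γ × Q × Q} (ht : t ∈ M.trans)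
    {R : Multiset Q} {y : Multiset (Q × Γ × Q × Q)}
    (h : M.Forest (t.1 ::ₘ t.2.2.1 ::ₘ R) y) : M.Forest (t.2.2.2 ::ₘ R) (t ::ₘ y) := by
  obtain ⟨y₁, y', rfl, h₁, h'⟩ := h.uncons
  obtain ⟨y₂, y₃, rfl, h₂, h₃⟩ := h'.uncons
  have := Forest.cons (Run.node ht h₁ h₂) h₃
  rwa [Multiset.cons_add, add_assoc] at this

/-- In a balanced multiset `y` of transitions with roots `q ::ₘ R` from which all targets are
reachable, some transition with target `q` can be placed at the root `q` such that `q`, if it is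
still needed as a target, remains reachable by the remaining transitions from the new roots.
This is the analogue of the choice of a non-bridge in Fleury's algorithm for Eulerian trails. -/
theorem exists_transition_keeping_reach [DecidableEq (Q × Γ × Q × Q)] {q : Q} {R W : Multiset Q}
    {y : Multiset (Q × Γ × Q × Q)} (hbal : (q ::ₘ R) + sources y = targets y + W)
    (hreach : ∀ t ∈ y, Reach {t | t ∈ y} {p | p ∈ q ::ₘ R} t.2.2.2)
    (hq : ∃ t ∈ y, t.2.2.2 = q) :
    ∃ t ∈ y, t.2.2.2 = q ∧ ((∃ t' ∈ y.erase t, t'.2.2.2 = q) →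
      Reach {t' | t' ∈ y.erase t} {p | p ∈ t.1 ::ₘ t.2.2.1 ::ₘ R} q) := by
  classical
  -- The transitions that do not leave `q` are not affected by the choice of `t`.
  set E : Set (Q × Γ × Q × Q) := {t | t ∈ y ∧ t.2.2.2 ≠ q} with hE
  have hEsub : ∀ t : Q × Γ × Q × Q, t.2.2.2 = q → E ⊆ {t' | t' ∈ y.erase t} := by
    rintro t ht t' ⟨h1, h2⟩
    exact (Multiset.mem_erase_of_ne (by rintro rfl; exact h2 ht)).2 h1
  by_cases hA : Reach E {p | p ∈ R} q
  · obtain ⟨t, ht, htq⟩ := hq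
    exact ⟨t, ht, htq, fun _ => hA.mono (hEsub t htq) fun p hp => by
      simp only [Set.mem_ofPred_eq] at hp ⊢
      simp [hp]⟩
  by_cases hone : ∃ t ∈ y, t.2.2.2 = q ∧ ¬ ∃ t' ∈ y.erase t, t'.2.2.2 = q
  · obtain ⟨t, ht, htq, hn⟩ := hone
    exact ⟨t, ht, htq, fun h => absurd h hn⟩
  -- Now `q` is a target at least twice, but a root only once, hence a source.
  have hqR : q ∉ R := fun h => hA (.root h)
  have hsrc : q ∈ sources y := by
    obtain ⟨t, ht, htq⟩ := hq
    obtain ⟨t', ht', htq'⟩ : ∃ t' ∈ y.erase t, t'.2.2.2 = q := by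
      by_contra hn
      exact hone ⟨t, ht, htq, hn⟩
    rw [← Multiset.count_pos]
    have h := congrArg (Multiset.count q) hbal
    have hy : y = t ::ₘ t' ::ₘ (y.erase t).erase t' := by
      rw [Multiset.cons_erase ht', Multiset.cons_erase ht]
    have h2 : 2 ≤ Multiset.count q (targets y) := by
      rw [hy, targets_cons, targets_cons, htq, htq']
      simp
    rw [Multiset.count_add, Multiset.count_add, Multiset.count_cons_self,
      Multiset.count_eq_zero_of_notMem hqR] at h
    omega
  obtain ⟨t', ht', hqt'⟩ : ∃ t' ∈ y, q = t'.1 ∨ q = t'.2.2.1 := by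
    rw [sources, Multiset.mem_add, Multiset.mem_map, Multiset.mem_map] at hsrc
    rcases hsrc with ⟨t', h, h'⟩ | ⟨t', h, h'⟩
    exacts [⟨t', h, .inl h'.symm⟩, ⟨t', h, .inr h'.symm⟩]
  by_cases hloop : t'.2.2.2 = q
  · refine ⟨t', ht', hloop, fun _ => .root ?_⟩
    rcases hqt' with h | h <;> simp [← h]
  -- Cut the path to a predecessor of `q` at its last visit to `q`.
  have hcut : ∀ p, Reach {t | t ∈ y} {p | p ∈ q ::ₘ R} p → p = q ∨ Reach E {p | p ∈ R} p ∨
      ∃ t ∈ y, t.2.2.2 = q ∧ Reach E {p | p = t.1 ∨ p = t.2.2.1} p := by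
    intro p hp
    induction hp with
    | root hp =>
      rcases Multiset.mem_cons.1 hp with rfl | hp
      exacts [.inl rfl, .inr (.inl (.root hp))]
    | @step u p hu _ hp ih =>
      by_cases huq : u.2.2.2 = q
      · exact .inr (.inr ⟨u, hu, huq, .root hp⟩)
      · rcases ih with h | h | ⟨t, ht, htq, h⟩
        exacts [absurd h huq, .inr (.inl (.step ⟨hu, huq⟩ h hp)),
          .inr (.inr ⟨t, ht, htq, .step ⟨hu, huq⟩ h hp⟩)]
  rcases hcut _ (hreach t' ht') with h | h | ⟨t, ht, htq, h⟩
  · exact absurd h hloop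
  · exact absurd (Reach.step (E := E) ⟨ht', hloop⟩ h hqt') hA
  · refine ⟨t, ht, htq, fun _ => (Reach.step (E := E) ⟨ht', hloop⟩ h hqt').mono (hEsub t htq) ?_⟩
    rintro p (rfl | rfl) <;> simp

/-- A balanced and connected multiset of transitions can be arranged to runs. -/
theorem Forest.of_balanced {M : TreeAutomaton Q Γ} {W : Multiset Q} (hW : ∀ q ∈ W, q ∈ M.final)
    {y : Multiset (Q × Γ × Q × Q)} {R : Multiset Q} (hy : ∀ t ∈ y, t ∈ M.trans)
    (hbal : R + sources y = targets y + W)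
    (hreach : ∀ t ∈ y, Reach {t | t ∈ y} {p | p ∈ R} t.2.2.2) : M.Forest R y := by
  classical
  induction hn : y.card generalizing y R with
  | zero =>
    obtain rfl := Multiset.card_eq_zero.1 hn
    obtain rfl : R = W := by simpa using hbal
    exact .of_final R hW
  | succ n ih =>
    obtain ⟨t₀, ht₀⟩ := Multiset.card_pos_iff_exists_mem.1 (hn ▸ n.succ_pos : 0 < y.card)
    have hroot : ∀ p, Reach {t | t ∈ y} {p | p ∈ R} p → (∃ t ∈ y, t.2.2.2 = p) →
        ∃ q ∈ R, ∃ t ∈ y, t.2.2.2 = q := by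
      intro p hp
      induction hp with
      | root hp => exact fun h => ⟨_, hp, h⟩
      | @step u p hu _ _ ih => exact fun _ => ih ⟨u, hu, rfl⟩
    obtain ⟨q, hqR, hq⟩ := hroot _ (hreach t₀ ht₀) ⟨t₀, ht₀, rfl⟩
    obtain ⟨R, rfl⟩ := Multiset.exists_cons_of_mem hqR
    obtain ⟨t, ht, rfl, hkeep⟩ := exists_transition_keeping_reach hbal hreach hq
    have hyt : t ::ₘ y.erase t = y := Multiset.cons_erase ht
    have hreach' : ∀ p, Reach {t | t ∈ y} {p | p ∈ t.2.2.2 ::ₘ R} p → p = t.2.2.2 ∨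
        Reach {t' | t' ∈ y.erase t} {p | p ∈ t.1 ::ₘ t.2.2.1 ::ₘ R} p := by
      intro p hp
      induction hp with
      | root hp =>
        rcases Multiset.mem_cons.1 hp with rfl | hp
        · exact .inl rfl
        · exact .inr (.root (by simp [hp]))
      | @step u p hu _ hp ih =>
        by_cases hut : u = t
        · subst hut
          exact .inr (.root (by rcases hp with rfl | rfl <;> simp))
        · have hu' : u ∈ y.erase t := (Multiset.mem_erase_of_ne hut).2 hu
          refine .inr (.step hu' ?_ hp)
          rcases ih with h | h
          · rw [h]
            exact hkeep ⟨u, hu', h⟩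
          · exact h
    have hforest : M.Forest (t.1 ::ₘ t.2.2.1 ::ₘ R) (y.erase t) := by
      refine ih (fun u hu => hy u (Multiset.mem_of_mem_erase hu)) ?_ (fun u hu => ?_) ?_
      · rw [← hyt, sources_cons, targets_cons] at hbal
        simp only [← Multiset.singleton_add] at hbal ⊢
        refine add_left_cancel (a := {t.2.2.2}) ?_
        rw [← add_assoc _ (targets _), ← hbal]
        abel
      · rcases hreach' _ (hreach u (Multiset.mem_of_mem_erase hu)) with h | h
        · rw [h]
          exact hkeep ⟨u, hu, h⟩
        · exact h
      · rw [Multiset.card_erase_of_mem ht, hn]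
        rfl
    rw [← hyt]
    exact hforest.node (hy t ht)

theorem Run.of_balanced {M : TreeAutomaton Q Γ} {q : Q} {W : Multiset Q}
    (hW : ∀ q ∈ W, q ∈ M.final) {y : Multiset (Q × Γ × Q × Q)} (hy : ∀ t ∈ y, t ∈ M.trans)
    (hbal : q ::ₘ sources y = targets y + W)
    (hreach : ∀ t ∈ y, Reach {t | t ∈ y} {q} t.2.2.2) : M.Run q y := by
  have h : M.Forest (q ::ₘ 0) y := .of_balanced hW hy (by simpa using hbal)
    (by simpa using hreach)
  obtain ⟨y₁, y₂, rfl, h₁, h₂⟩ := h.uncons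
  obtain rfl := h₂.eq_zero rfl
  simpa using h₁

end TreeAutomaton

/-! ### Sizes of formulas -/

section FormulaSize

open Language

variable {𝓛 : Language} {α ι : Type*} {n : ℕ}

theorem formulaSize_not (a : 𝓛.BoundedFormula α n) : formulaSize a.not = formulaSize a + 2 := by
  simp only [formulaSize]
  omega

theorem formulaSize_top : formulaSize (⊤ : 𝓛.BoundedFormula α n) = 3 := formulaSize_not _

theorem formulaSize_bot : formulaSize (⊥ : 𝓛.BoundedFormula α n) = 1 := rfl

theorem formulaSize_inf (a b : 𝓛.BoundedFormula α n) :
    formulaSize (a ⊓ b) = formulaSize a + formulaSize b + 5 := by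
  change formulaSize (BoundedFormula.not (a.imp b.not)) = _
  rw [formulaSize_not, formulaSize, formulaSize_not]
  omega

theorem formulaSize_sup (a b : 𝓛.BoundedFormula α n) :
    formulaSize (a ⊔ b) = formulaSize a + formulaSize b + 3 := by
  change formulaSize (a.not.imp b) = _
  rw [formulaSize, formulaSize_not]
  omega

theorem formulaSize_bdEqual (t u : 𝓛.Term (α ⊕ Fin n)) :
    formulaSize (t.bdEqual u) = termSize t + termSize u + 1 := by
  simp only [Term.bdEqual, formulaSize]
  omega

theorem formulaSize_exs (a : 𝓛.BoundedFormula α n) :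
    formulaSize a.exs = formulaSize a + 5 * n := by
  induction n with
  | zero => rfl
  | succ n ih =>
    rw [BoundedFormula.exs, ih, BoundedFormula.ex, formulaSize_not, formulaSize, formulaSize_not]
    omega

theorem termSize_zero : termSize (0 : presburger.Term α) = 1 := rfl

theorem termSize_one : termSize (1 : presburger.Term α) = 1 := rfl

theorem termSize_add (t u : presburger.Term α) :
    termSize (t + u) = termSize t + termSize u + 1 := by
  change 1 + ∑ i : Fin 2, termSize (![t, u] i) = _
  simp
  omega

theorem termSize_sum_var (s : Finset ι) (f : ι → α) :
    termSize (presburger.sum s fun i => Term.var (f i)) = 2 * s.card + 1 := by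
  rw [presburger.sum, ← Finset.length_toList]
  generalize s.toList = l
  induction l with
  | nil => rfl
  | cons a l ih =>
    rw [List.map_cons, List.sum_cons, termSize_add, ih, List.length_cons, termSize]
    omega

/-- The conjunction of a finite family of formulas. -/
noncomputable def finsetConj (s : Finset ι) (f : ι → 𝓛.BoundedFormula α n) :
    𝓛.BoundedFormula α n :=
  (s.toList.map f).foldr (· ⊓ ·) ⊤

/-- The disjunction of a finite family of formulas. -/
noncomputable def finsetDisj (s : Finset ι) (f : ι → 𝓛.BoundedFormula α n) :
    𝓛.BoundedFormula α n :=
  (s.toList.map f).foldr (· ⊔ ·) ⊥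

theorem realize_finsetConj {N : Type*} [𝓛.Structure N] {s : Finset ι}
    {f : ι → 𝓛.BoundedFormula α n} {v : α → N} {xs : Fin n → N} :
    (finsetConj s f).Realize v xs ↔ ∀ i ∈ s, (f i).Realize v xs := by
  simp [finsetConj, BoundedFormula.realize_foldr_inf]

theorem realize_finsetDisj {N : Type*} [𝓛.Structure N] {s : Finset ι}
    {f : ι → 𝓛.BoundedFormula α n} {v : α → N} {xs : Fin n → N} :
    (finsetDisj s f).Realize v xs ↔ ∃ i ∈ s, (f i).Realize v xs := by
  simp [finsetDisj, BoundedFormula.realize_foldr_sup]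

theorem isQF_finsetConj {s : Finset ι} {f : ι → 𝓛.BoundedFormula α n} (h : ∀ i, (f i).IsQF) :
    (finsetConj s f).IsQF := by
  rw [finsetConj]
  generalize s.toList = l
  induction l with
  | nil => exact .top
  | cons a l ih => exact (h a).inf ih

theorem isQF_finsetDisj {s : Finset ι} {f : ι → 𝓛.BoundedFormula α n} (h : ∀ i, (f i).IsQF) :
    (finsetDisj s f).IsQF := by
  rw [finsetDisj]
  generalize s.toList = l
  induction l with
  | nil => exact BoundedFormula.isQF_bot
  | cons a l ih => exact (h a).sup ih

theorem formulaSize_finsetConj (s : Finset ι) (f : ι → 𝓛.BoundedFormula α n) :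
    formulaSize (finsetConj s f) = ∑ i ∈ s, (formulaSize (f i) + 5) + 3 := by
  rw [finsetConj, ← Finset.sum_map_toList]
  generalize s.toList = l
  induction l with
  | nil => exact formulaSize_top
  | cons a l ih =>
    rw [List.map_cons, List.foldr_cons, formulaSize_inf, ih, List.map_cons, List.sum_cons]
    omega

theorem formulaSize_finsetDisj (s : Finset ι) (f : ι → 𝓛.BoundedFormula α n) :
    formulaSize (finsetDisj s f) = ∑ i ∈ s, (formulaSize (f i) + 3) + 1 := by
  rw [finsetDisj, ← Finset.sum_map_toList]
  generalize s.toList = l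
  induction l with
  | nil => exact formulaSize_bot
  | cons a l ih =>
    rw [List.map_cons, List.foldr_cons, formulaSize_sup, ih, List.map_cons, List.sum_cons]
    omega

end FormulaSize

/-! ### The Parikh image in arithmetic terms -/

namespace TreeAutomaton

variable {Q Γ : Type*}

/-- Breadth-first distances along reachability. -/
theorem exists_distance {E : Set (Q × Γ × Q × Q)} {q₀ : Q} :
    ∃ z : Q → ℕ, ∀ q, Reach E {q₀} q → q ≠ q₀ →
      ∃ t ∈ E, (t.1 = q ∨ t.2.2.1 = q) ∧ z q = z t.2.2.2 + 1 := by
  classical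
  -- `N n q`: there is a path from `q₀` to `q` of length `n`.
  let N : ℕ → Q → Prop := fun n => Nat.rec (fun q => q = q₀)
    (fun _ P q => ∃ t ∈ E, (t.1 = q ∨ t.2.2.1 = q) ∧ P t.2.2.2) n
  have hN : ∀ q, Reach E {q₀} q → ∃ n, N n q := by
    intro q hq
    induction hq with
    | root h => exact ⟨0, h⟩
    | @step t q ht _ hq ih =>
      obtain ⟨n, hn⟩ := ih
      exact ⟨n + 1, t, ht, hq.imp Eq.symm Eq.symm, hn⟩
  refine ⟨fun q => sInf {n | N n q}, fun q hq hne => ?_⟩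
  have hmem : N (sInf {n | N n q}) q := Nat.sInf_mem (hN q hq)
  dsimp only
  generalize hz : sInf {n | N n q} = d at hmem
  cases d with
  | zero => exact absurd hmem hne
  | succ d =>
    obtain ⟨t, ht, hqt, hd⟩ := hmem
    refine ⟨t, ht, hqt, ?_⟩
    have h1 : sInf {n | N n t.2.2.2} ≤ d := Nat.sInf_le hd
    have hd' : N (sInf {n | N n t.2.2.2}) t.2.2.2 := Nat.sInf_mem (s := {n | N n t.2.2.2}) ⟨d, hd⟩
    have h2 : sInf {n | N n q} ≤ sInf {n | N n t.2.2.2} + 1 := Nat.sInf_le ⟨t, ht, hqt, hd'⟩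
    omega

/-- Counting the images of a multiset of transitions by the multiplicities of the transitions. -/
theorem count_map_eq_sum {T B : Type*} [DecidableEq T] [DecidableEq B] {s : Set T} [Fintype s] {y : Multiset T}
    (hy : ∀ t ∈ y, t ∈ s) (g : T → B) (b : B) :
    (y.map g).count b = ∑ t : s with g t.1 = b, y.count t.1 := by
  induction y using Multiset.induction with
  | empty => simp
  | cons a y ih =>
    have ha : a ∈ s := hy a (by simp)
    simp only [Multiset.map_cons, Multiset.count_cons, Finset.sum_add_distrib]
    rw [ih fun t ht => hy t (by simp [ht])]
    congr 1
    have h : ∀ t : s, (t.1 = a) ↔ (t = ⟨a, ha⟩) := fun t => (Subtype.ext_iff (a2 := ⟨a, ha⟩)).symm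
    simp only [h, Finset.sum_ite_eq', Finset.mem_filter, Finset.mem_univ, true_and, eq_comm]

theorem exists_multiset_count {T : Type*} [DecidableEq T] {s : Set T} [Fintype s] (f : s → ℕ) :
    ∃ y : Multiset T, (∀ t ∈ y, t ∈ s) ∧ ∀ t : s, y.count t.1 = f t := by
  refine ⟨(∑ t : s, f t • {t.1} : Multiset T), fun t ht => ?_, fun t => ?_⟩
  · obtain ⟨u, -, hu⟩ := Multiset.mem_sum.1 ht
    have := Multiset.mem_of_mem_nsmul hu
    rw [Multiset.mem_singleton] at this
    exact this ▸ u.2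
  · rw [Multiset.count_sum']
    simp [Multiset.count_singleton, Subtype.ext_iff.symm]

open scoped Classical in
/-- The arithmetic description of the letter counts `v` of accepted trees: `y` counts the uses of
the transitions, `w` counts the empty subtrees at final states, and `z` is the distance of a
used state from the initial state along used transitions, which expresses connectedness. -/
def ParikhEquations {m : ℕ} (M : TreeAutomaton Q Γ) [Fintype M.trans] (L : Fin m → Γ)
    (v : Fin m → ℕ) (y : M.trans → ℕ) (w z : Q → ℕ) : Prop :=
  (∀ q, (if q = M.init then 1 else 0) +
      ((∑ t : M.trans with t.1.1 = q, y t) + ∑ t : M.trans with t.1.2.2.1 = q, y t) =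
        (∑ t : M.trans with t.1.2.2.2 = q, y t) + if q ∈ M.final then w q else 0) ∧
  (∀ q, q = M.init ∨ (∑ t : M.trans with t.1.2.2.2 = q, y t) = 0 ∨
    ∃ t : M.trans, (t.1.1 = q ∨ t.1.2.2.1 = q) ∧ y t ≠ 0 ∧ z q = z t.1.2.2.2 + 1) ∧
  ∀ i, v i = ∑ t : M.trans with t.1.2.1 = L i, y t

theorem exists_parikhEquations_iff {m : ℕ} (M : TreeAutomaton Q Γ) [Fintype M.trans]
    (L : Fin m → Γ) (v : Fin m → ℕ) :
    (∃ y w z, M.ParikhEquations L v y w z) ↔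
      ∃ t ∈ M.lang fun γ => {γ}, ∀ i, v i = t.count (L i) := by
  classical
  have := M.finite_states
  constructor
  · rintro ⟨f, w, z, hbal, hconn, hcount⟩
    obtain ⟨y, hy, hyf⟩ := exists_multiset_count f
    have hsum : ∀ {B : Type _} (g : Q × Γ × Q × Q → B) (b : B),
        ∑ t : M.trans with g t.1 = b, f t = (y.map g).count b := fun g b => by
      simp only [count_map_eq_sum hy, hyf]
    have hsum' : ∀ (g : Q × Γ × Q × Q → Γ) (b : Γ),
        ∑ t : M.trans with g t.1 = b, f t = (y.map g).count b := fun g b => by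
      simp only [count_map_eq_sum hy, hyf]
    obtain ⟨W, hW, hWw⟩ : ∃ W : Multiset Q, (∀ q ∈ W, q ∈ M.final) ∧
        ∀ q, W.count q = if q ∈ M.final then w q else 0 := by
      have := Fintype.ofFinite M.final
      obtain ⟨W, hW, hWw⟩ := exists_multiset_count (s := M.final) fun q => w q
      refine ⟨W, hW, fun q => ?_⟩
      split_ifs with hq
      · exact hWw ⟨q, hq⟩
      · exact Multiset.count_eq_zero_of_notMem fun h => hq (hW q h)
    have hrun : M.Run M.init y := by
      refine .of_balanced hW hy ?_ ?_
      · ext q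
        have := hbal q
        rw [hsum (fun t => t.1), hsum (fun t => t.2.2.1), hsum (fun t => t.2.2.2), ← hWw] at this
        simp only [Multiset.count_cons, sources, targets, Multiset.count_add]
        omega
      · -- The distance decreases along a path back to the initial state.
        suffices H : ∀ n q, z q = n → (∃ t ∈ y, t.2.2.2 = q) → Reach {t | t ∈ y} {M.init} q from
          fun t ht => H _ _ rfl ⟨t, ht, rfl⟩
        intro n
        induction n with
        | zero =>
          rintro q hz ⟨t, ht, rfl⟩
          rcases hconn t.2.2.2 with h | h | ⟨u, hu, hu0, hzu⟩
          · exact .root h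
          · rw [hsum (fun t => t.2.2.2)] at h
            exact absurd (Multiset.mem_map_of_mem _ ht) (Multiset.count_eq_zero.1 h)
          · omega
        | succ n ih =>
          rintro q hz ⟨t, ht, rfl⟩
          rcases hconn t.2.2.2 with h | h | ⟨u, hu, hu0, hzu⟩
          · exact .root h
          · rw [hsum (fun t => t.2.2.2)] at h
            exact absurd (Multiset.mem_map_of_mem _ ht) (Multiset.count_eq_zero.1 h)
          · have huy : u.1 ∈ y := by
              rw [← Multiset.count_pos, hyf]
              omega
            exact .step (E := {t | t ∈ y}) huy (ih _ (by omega) ⟨u, huy, rfl⟩)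
              (hu.imp Eq.symm Eq.symm)
    obtain ⟨t, ht, hct⟩ := hrun.exists_acceptsAt
    exact ⟨t, ht, fun i => by rw [hcount, hct, hsum' (fun t => t.2.1)]⟩
  · rintro ⟨t, ht, hv⟩
    obtain ⟨y, hrun, hct⟩ := AcceptsAt.exists_run ht
    have hy := hrun.subset_trans
    obtain ⟨W, hW, hbal⟩ := hrun.balanced
    obtain ⟨z, hz⟩ := exists_distance (E := {t | t ∈ y}) (q₀ := M.init)
    refine ⟨fun t => y.count t.1, fun q => W.count q, z, fun q => ?_, fun q => ?_, fun i => ?_⟩ <;>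
      dsimp only
    · have hq := congrArg (Multiset.count q) hbal
      have hWq : (if q ∈ M.final then W.count q else 0) = W.count q := by
        split_ifs with h
        · rfl
        · exact (Multiset.count_eq_zero_of_notMem fun h' => h (hW q h')).symm
      rw [hWq, ← count_map_eq_sum hy (fun t => t.1), ← count_map_eq_sum hy (fun t => t.2.2.1),
        ← count_map_eq_sum hy (fun t => t.2.2.2)]
      simp only [Multiset.count_cons, sources, targets, Multiset.count_add] at hq
      omega
    · by_cases h0 : q = M.init
      · exact .inl h0
      rw [← count_map_eq_sum hy (fun t => t.2.2.2)]
      by_cases hq : q ∈ y.map fun t => t.2.2.2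
      · obtain ⟨u, hu, rfl⟩ := Multiset.mem_map.1 hq
        obtain ⟨t, ht, hqt, hzt⟩ := hz _ (hrun.reach u hu) h0
        exact .inr (.inr ⟨⟨t, hy t ht⟩, hqt, (Multiset.count_pos.2 ht).ne', hzt⟩)
      · exact .inr (.inl (Multiset.count_eq_zero_of_notMem hq))
    · rw [hv, hct, count_map_eq_sum hy (fun t => t.2.1)]

/-! ### The Presburger formula for the Parikh image -/

section Formula

open Language

variable {m : ℕ}

open scoped Classical in
/-- An existential Presburger formula that expresses `ParikhEquations`. Its bound variables are
indexed, through an enumeration, by the transitions and twice by the states. -/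
theorem exists_presburger_parikhEquations (M : TreeAutomaton Q Γ) {L : Fin m → Γ}
    (hL : Function.Injective L) [Fintype M.trans] [Fintype Q] :
    ∃ ρ : presburger.Formula (Fin m), IsExistentialFormula ρ ∧
      (∀ v : Fin m → ℕ, ρ.Realize v ↔ ∃ y w z, M.ParikhEquations L v y w z) ∧
      formulaSize ρ ≤ 100 * (1 + m + Fintype.card Q + Fintype.card M.trans) := by
  obtain ⟨n, ⟨e⟩⟩ : ∃ n, Nonempty ((M.trans ⊕ Q ⊕ Q) ≃ Fin n) := ⟨_, ⟨Fintype.equivFin _⟩⟩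
  let y : M.trans → Fin m ⊕ Fin n := fun t => .inr (e (.inl t))
  let w : Q → Fin m ⊕ Fin n := fun q => .inr (e (.inr (.inl q)))
  let z : Q → Fin m ⊕ Fin n := fun q => .inr (e (.inr (.inr q)))
  let src₁ : Q → Finset M.trans := fun q => {t | t.1.1 = q}
  let src₂ : Q → Finset M.trans := fun q => {t | t.1.2.2.1 = q}
  let tgt : Q → Finset M.trans := fun q => {t | t.1.2.2.2 = q}
  let lab : Fin m → Finset M.trans := fun i => {t | t.1.2.1 = L i}
  let total : Finset M.trans → presburger.Term (Fin m ⊕ Fin n) := fun s => presburger.sum s fun t => .var (y t)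
  let balance : Q → presburger.BoundedFormula (Fin m) n := fun q =>
    ((if q = M.init then 1 else 0) + (total (src₁ q) + total (src₂ q))).bdEqual
      (total (tgt q) + if q ∈ M.final then .var (w q) else 0)
  let pred : Q → M.trans → presburger.BoundedFormula (Fin m) n := fun q t =>
    ((Term.var (y t)).bdEqual 0).not ⊓
      (Term.var (z q)).bdEqual (.var (z t.1.2.2.2) + 1)
  let conn : Q → presburger.BoundedFormula (Fin m) n := fun q =>
    if q = M.init then ⊤ else
      (total (tgt q)).bdEqual 0 ⊔ finsetDisj (src₁ q ∪ src₂ q) (pred q)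
  let letters : Fin m → presburger.BoundedFormula (Fin m) n := fun i => (Term.var (.inl i)).bdEqual (total (lab i))
  let θ : presburger.BoundedFormula (Fin m) n := finsetConj .univ balance ⊓ (finsetConj .univ conn ⊓ finsetConj .univ letters)
  have hQF : ∀ t u : presburger.Term (Fin m ⊕ Fin n), (t.bdEqual u).IsQF := fun t u =>
    (BoundedFormula.IsAtomic.equal t u).isQF
  refine ⟨θ.exs, ⟨_, θ, ?_, rfl⟩, fun v => ?_, ?_⟩
  · refine (isQF_finsetConj fun q => hQF _ _).inf
      ((isQF_finsetConj fun q => ?_).inf (isQF_finsetConj fun i => hQF _ _))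
    simp only [conn]
    split_ifs
    · exact .top
    · exact (hQF _ _).sup (isQF_finsetDisj fun t => (hQF _ _).not.inf (hQF _ _))
  · have key : ∀ xs, θ.Realize v xs ↔ M.ParikhEquations L v (fun t => xs (e (.inl t)))
        (fun q => xs (e (.inr (.inl q)))) (fun q => xs (e (.inr (.inr q)))) := by
      intro xs
      simp only [θ, BoundedFormula.realize_inf, realize_finsetConj, ParikhEquations,
        Finset.mem_univ, true_imp_iff]
      refine and_congr (forall_congr' fun q => ?_) (and_congr (forall_congr' fun q => ?_)
        (forall_congr' fun i => ?_))
      · simp only [balance, BoundedFormula.realize_bdEqual, presburger.realize_add, total,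
          presburger.realize_sum, Term.realize_var, src₁, src₂, tgt, y, w, Sum.elim_inr,
          apply_ite (Term.realize (Sum.elim v xs)), presburger.realize_one,
          presburger.realize_zero]
      · by_cases hq : q = M.init
        · simp [conn, hq]
        · simp only [conn, hq, if_false, BoundedFormula.realize_sup, false_or,
            BoundedFormula.realize_bdEqual, realize_finsetDisj, pred, BoundedFormula.realize_inf,
            BoundedFormula.realize_not, presburger.realize_add, total, presburger.realize_sum,
            Term.realize_var, src₁, src₂, tgt, y, z, Sum.elim_inr, presburger.realize_one,
            presburger.realize_zero, Finset.mem_union, Finset.mem_filter, Finset.mem_univ,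
            true_and, ne_eq]
      · simp only [letters, BoundedFormula.realize_bdEqual, total, presburger.realize_sum,
          Term.realize_var, lab, y, Sum.elim_inr, Sum.elim_inl]
    rw [BoundedFormula.realize_exs]
    simp only [key]
    constructor
    · rintro ⟨xs, h⟩
      exact ⟨_, _, _, h⟩
    · rintro ⟨f, g, h, H⟩
      exact ⟨fun i => Sum.elim f (Sum.elim g h) (e.symm i), by simpa using H⟩
  · have hbalance : ∀ q, formulaSize (balance q) =
        2 * (src₁ q).card + 2 * (src₂ q).card + 2 * (tgt q).card + 9 := by
      intro q
      simp only [balance, formulaSize_bdEqual, termSize_add, total, termSize_sum_var,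
        apply_ite termSize, termSize_zero, termSize_one, termSize, ite_self]
      omega
    have hpred : ∀ q t, formulaSize (pred q t) = 15 := by
      intro q t
      simp only [pred, formulaSize_inf, formulaSize_not, formulaSize_bdEqual, termSize_add,
        termSize_zero, termSize_one, termSize]
    have hconn : ∀ q, formulaSize (conn q) ≤
        2 * (tgt q).card + 18 * ((src₁ q).card + (src₂ q).card) + 7 := by
      intro q
      have hcard := Finset.card_union_le (src₁ q) (src₂ q)
      by_cases hq : q = M.init
      · simp only [conn, hq, if_true, formulaSize_top]
        omega
      · simp only [conn, hq, if_false, formulaSize_sup, formulaSize_finsetDisj, hpred,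
          formulaSize_bdEqual, total, termSize_sum_var, termSize_zero, Finset.sum_const,
          smul_eq_mul]
        omega
    have hletters : ∀ i, formulaSize (letters i) = 2 * (lab i).card + 3 := by
      intro i
      simp only [letters, formulaSize_bdEqual, total, termSize_sum_var, termSize]
      omega
    have hfiber : ∀ g : M.trans → Q, ∑ q, (Finset.univ.filter fun t => g t = q).card =
        Fintype.card M.trans := fun g =>
      (Finset.card_eq_sum_card_fiberwise fun t _ => Finset.mem_coe.2 (Finset.mem_univ (g t))).symm
    have h₁ : ∑ q, (src₁ q).card = Fintype.card M.trans := hfiber _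
    have h₂ : ∑ q, (src₂ q).card = Fintype.card M.trans := hfiber _
    have h₃ : ∑ q, (tgt q).card = Fintype.card M.trans := hfiber _
    have h₄ : ∑ i, (lab i).card ≤ Fintype.card M.trans := by
      rw [← Finset.card_biUnion]
      · exact Finset.card_le_univ _
      · intro i _ j _ hij
        refine Finset.disjoint_left.2 fun t hi hj => hij (hL ?_)
        simp only [lab, Finset.mem_filter, Finset.mem_univ, true_and] at hi hj
        rw [← hi, hj]
    have hn : Fintype.card M.trans + (Fintype.card Q + Fintype.card Q) = n := by
      simpa using Fintype.card_congr e
    have hconn' : ∑ q, formulaSize (conn q) ≤ 38 * Fintype.card M.trans + 7 * Fintype.card Q := by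
      refine (Finset.sum_le_sum fun q _ => hconn q).trans (le_of_eq ?_)
      simp only [Finset.sum_add_distrib, ← Finset.mul_sum, h₁, h₂, h₃, Finset.sum_const,
        Finset.card_univ, smul_eq_mul]
      ring
    simp only [θ, formulaSize_exs, formulaSize_inf, formulaSize_finsetConj, hbalance, hletters,
      Finset.sum_add_distrib, ← Finset.mul_sum, h₁, h₂, h₃, Finset.sum_const, Finset.card_univ,
      smul_eq_mul, Fintype.card_fin]
    omega

end Formula

theorem card_trans_relabel_le {Γ' : Type*} {m : ℕ} (M : TreeAutomaton Q Γ) {ψ : Fin m → Γ}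
    (hψ : Function.Injective ψ) (L : Fin m → Γ') :
    (M.relabel ψ L).trans.ncard ≤ M.trans.ncard := by
  -- Each relabelled transition comes from a transition of `M`, which determines it.
  let f : {t : Q × Γ × Q × Q // t ∈ M.trans} → Set (Q × Γ' × Q × Q) := fun t =>
    {t' | ∃ j, t'.2.1 = L j ∧ t.1 = (t'.1, ψ j, t'.2.2)}
  have hex : ∀ t : (M.relabel ψ L).trans, ∃ t' : M.trans, t.1 ∈ f t' := fun ⟨t, j, h, h'⟩ =>
    ⟨⟨_, h'⟩, j, h, rfl⟩
  choose g hg using hex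
  have := M.finite_trans.to_subtype
  rw [← Nat.card_coe_set_eq, ← Nat.card_coe_set_eq]
  refine Nat.card_le_card_of_injective g fun t u h => ?_
  obtain ⟨i, hi, hi'⟩ := hg t
  obtain ⟨j, hj, hj'⟩ := hg u
  rw [h, hj'] at hi'
  simp only [Prod.mk.injEq] at hi'
  obtain ⟨h1, h2, h3⟩ := hi'
  refine Subtype.ext (Prod.ext h1.symm (Prod.ext ?_ h3.symm))
  rw [hi, hj, hψ h2]

theorem card_guards_le {m : ℕ} (M : TreeAutomaton Q Γ) {ψ : Fin m → Γ}
    (hψ : Function.Injective ψ) (hr : Set.range ψ = M.guards) : m ≤ M.trans.ncard := by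
  have h : M.guards = (fun t : Q × Γ × Q × Q => t.2.1) '' M.trans := by
    ext γ
    constructor
    · rintro ⟨q₁, q₂, q₃, h⟩
      exact ⟨_, h, rfl⟩
    · rintro ⟨⟨q₁, γ, q₂, q₃⟩, h, rfl⟩
      exact ⟨q₁, q₂, q₃, h⟩
  calc m = (Set.range ψ).ncard := by
        rw [← Set.image_univ, Set.ncard_image_of_injective _ hψ, Set.ncard_univ, Nat.card_fin]
    _ ≤ M.trans.ncard := by
        rw [hr, h]
        exact Set.ncard_image_le M.finite_trans

/-- The Parikh image has an existential Presburger definition of linear size. -/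
theorem exists_presburger_parikh {k m : ℕ} (M : TreeAutomaton Q Γ) {ψ : Fin m → Γ}
    {L : Fin m → PropFormula k} (hψ : Function.Injective ψ) (hL : Function.Injective L)
    (hr : Set.range ψ = M.guards) :
    ∃ ρ : Language.presburger.Formula (Fin m),
      DefinesExistentially ρ (M.parikh ψ L) ∧ formulaSize ρ ≤ 100 * M.size := by
  have := M.finite_states
  have := Fintype.ofFinite Q
  have := (M.relabel ψ L).finite_trans.fintype
  obtain ⟨ρ, hex, hρ, hsize⟩ := (M.relabel ψ L).exists_presburger_parikhEquations hL
  refine ⟨ρ, ⟨hex, fun v => (hρ v).trans (exists_parikhEquations_iff _ L v)⟩, hsize.trans ?_⟩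
  have h₁ := M.card_trans_relabel_le hψ L
  have h₂ := M.card_guards_le hψ hr
  rw [← Nat.card_coe_set_eq, Nat.card_eq_fintype_card] at h₁
  rw [size, Nat.card_eq_fintype_card]
  omega

end TreeAutomaton

theorem theorem1 :
    ∃ C : ℕ, ∀ (D Ψ Q : Type*) [Primcodable Ψ] (A : EffectiveBooleanAlgebra D Ψ)
      (M : SymbolicTreeAutomaton A Q) (k m : ℕ) (φ : Fin k → Ψ) (ψ : Fin m → Ψ)
      (L : Fin m → PropFormula k),
      SymbolicTreeAutomaton.Presentation A M φ ψ L →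
      ((SymbolicTreeAutomaton.language A M).Nonempty ↔
        SymbolicTreeAutomaton.TablePower A M φ ψ L) ∧
      (∃ ρ : FirstOrder.Language.presburger.Formula (Fin m),
        DefinesExistentially ρ (TreeAutomaton.parikh M ψ L) ∧
        formulaSize ρ ≤ C * TreeAutomaton.size M) ∧
      ∀ ρ : FirstOrder.Language.presburger.Formula (Fin m),
        DefinesExistentially ρ (TreeAutomaton.parikh M ψ L) →
        (SymbolicTreeAutomaton.TablePower A M φ ψ L ↔ ElimProp A φ L ρ) := by
  refine ⟨100, fun D Ψ Q _ A M k m φ ψ L hP => ⟨?_, ?_, fun ρ hρ => ?_⟩⟩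
  · exact SymbolicTreeAutomaton.language_nonempty_iff_tablePower hP
  · exact TreeAutomaton.exists_presburger_parikh M hP.guard_injective hP.formula_injective
      hP.range_guard
  · exact SymbolicTreeAutomaton.tablePower_iff_elimProp hP hρ.2
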